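/- Let $\mathrm{Ai}$ be the (entire) Airy function, $\alpha = 2\pi/3$, $\kappa \ge 0$ a fixed real number, and for $\lambda \in \mathbb{C}$ and $x\in\mathbb{R}$ put $$w_x = ix+\lambda, \qquad f(\lambda) = 2\pi\,\mathrm{Ai}'(e^{-i\alpha}\lambda)\,\mathrm{Ai}'(e^{i\alpha}\lambda).$$ Let $\mathcal{G}_1(x,y;\lambda)=\mathcal{G}_1(x,y;\lambda,\kappa)$ be the boundary part of the resolvent kernel of the operator $-\frac{d^2}{dx^2}-ix$ on the line with the transmission condition $u'(0^+)=u'(0^-)=\kappa\,(u(0^+)-u(0^-))$, i.e. the kernel (to be added to the resolvent kernel of $-\frac{d^2}{dx^2}-ix$ on $\mathbb{R}$ without transmission condition) given, whenever $f(\lambda)+\kappa\neq 0$, by $$\mathcal{G}_1(x,y;\lambda)=\begin{cases} -4\pi^2\,\dfrac{e^{2i\alpha}[\mathrm{Ai}'(e^{i\alpha}\lambda)]^2}{f(\lambda)+\kappa}\,\mathrm{Ai}(e^{-i\alpha}w_x)\,\mathrm{Ai}(e^{-i\alpha}w_y), & x>0,\ y>0,\\[2mm] -2\pi\,\dfrac{f(\lambda)}{f(\lambda)+\kappa}\,\mathrm{Ai}(e^{i\alpha}w_x)\,\mathrm{Ai}(e^{-i\alpha}w_y),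 & x<0,\ y>0,\\[2mm] -2\pi\,\dfrac{f(\lambda)}{f(\lambda)+\kappa}\,\mathrm{Ai}(e^{-i\alpha}w_x)\,\mathrm{Ai}(e^{i\alpha}w_y), & x>0,\ y<0,\\[2mm] -4\pi^2\,\dfrac{e^{-2i\alpha}[\mathrm{Ai}'(e^{-i\alpha}\lambda)]^2}{f(\lambda)+\kappa}\,\mathrm{Ai}(e^{i\alpha}w_x)\,\mathrm{Ai}(e^{i\alpha}w_y), & x<0,\ y<0. \end{cases}$$ Then, for every $\lambda_0>0$, $$\lim_{\eta\to+\infty}\|\mathcal{G}_1(\cdot,\cdot;\lambda_0+i\eta)\|_{L^2(\mathbb{R}^2)}=0 \quad\text{and}\quad \lim_{\eta\to-\infty}\|\mathcal{G}_1(\cdot,\cdot;\lambda_0+i\eta)\|_{L^2(\mathbb{R}^2)}=0 .$$ Moreover, the convergence is uniform for $\lambda_0$ in compact sets: for every compact $K\subset(0,+\infty)$, $$\lim_{\eta\to\pm\infty}\ \sup_{\lambda_0\in K}\|\mathcal{G}_1(\cdot,\cdot;\lambda_0+i\eta)\|_{L^2(\mathbb{R}^2)}=0 .$$ -/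

import Mathlib

open MeasureTheory Filter Topology
open scoped ENNReal

noncomputable section

/-- The entire Airy function `Ai`, by its standard contour representation
`Ai z = (1 / (2 π i)) ∫ exp (t ^ 3 / 3 - z t) dt`, where the contour comes from infinity along the
ray `arg t = -π / 3` to the origin and returns to infinity along the ray `arg t = π / 3`.
On both rays `t = r e^{± i π / 3}` one has `t ^ 3 = - r ^ 3`, so that the integral converges
absolutely for every complex `z`. -/
def airyAi (z : ℂ) : ℂ :=
  (1 / (2 * Real.pi * Complex.I)) *
    ∫ r in Set.Ioi (0 : ℝ),
      Complex.exp (-(r : ℂ) ^ 3 / 3) *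
        (Complex.exp (Real.pi / 3 * Complex.I) *
            Complex.exp (-(z * (r * Complex.exp (Real.pi / 3 * Complex.I)))) -
          Complex.exp (-(Real.pi / 3 * Complex.I)) *
            Complex.exp (-(z * (r * Complex.exp (-(Real.pi / 3 * Complex.I))))))

/-- The derivative `Ai'` of the Airy function. -/
def airyAiDeriv (z : ℂ) : ℂ := deriv airyAi z

/-- `e^{iα}` with `α = 2 π / 3`. -/
def rotPos : ℂ := Complex.exp (2 * Real.pi / 3 * Complex.I)

/-- `e^{-iα}` with `α = 2 π / 3`. -/
def rotNeg : ℂ := Complex.exp (-(2 * Real.pi / 3 * Complex.I))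

/-- `f(lam) = 2 π Ai'(e^{-iα} lam) Ai'(e^{iα} lam)`. -/
def airyF (lam : ℂ) : ℂ :=
  2 * Real.pi * airyAiDeriv (rotNeg * lam) * airyAiDeriv (rotPos * lam)

/-- `w_x = i x + lam`. -/
def airyArg (lam : ℂ) (x : ℝ) : ℂ := Complex.I * x + lam

/-- The part `G₁(x, y; lam, κ)` of the resolvent kernel of `-d²/dx² - i x` on the line, with the
transmission condition `u'(0⁺) = u'(0⁻) = κ (u(0⁺) - u(0⁻))`, which is added to the kernel
`G₀(x, y; lam)` of the resolvent of `-d²/dx² - i x` on the line without barrier.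
The values on the null set where `x = 0` or `y = 0` are immaterial. -/
def transmissionG₁ (κ : ℝ) (lam : ℂ) (x y : ℝ) : ℂ :=
  if 0 < y then
    if 0 < x then
      -(4 * Real.pi ^ 2 * (rotPos ^ 2 * airyAiDeriv (rotPos * lam) ^ 2 / (airyF lam + κ)) *
        airyAi (rotNeg * airyArg lam x) * airyAi (rotNeg * airyArg lam y))
    else
      -(2 * Real.pi * (airyF lam / (airyF lam + κ)) *
        airyAi (rotPos * airyArg lam x) * airyAi (rotNeg * airyArg lam y))
  else
    if 0 < x then
      -(2 * Real.pi * (airyF lam / (airyF lam + κ)) *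
        airyAi (rotNeg * airyArg lam x) * airyAi (rotPos * airyArg lam y))
    else
      -(4 * Real.pi ^ 2 * (rotNeg ^ 2 * airyAiDeriv (rotNeg * lam) ^ 2 / (airyF lam + κ)) *
        airyAi (rotPos * airyArg lam x) * airyAi (rotPos * airyArg lam y))

/-- The Hilbert–Schmidt norm of `G₁`, that is, the norm of the kernel in `L²(ℝ²)` for Lebesgue
measure, with values in `[0, ∞]`. -/
def normG₁ (κ : ℝ) (lam : ℂ) : ℝ≥0∞ :=
  eLpNorm (fun p : ℝ × ℝ => transmissionG₁ κ lam p.1 p.2) 2 volume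

end

/-!
The kernel is, on each quadrant, a constant times a product of a function of `x` and a function of
`y`, so its Hilbert–Schmidt norm is explicit in terms of the coefficients and of the `L²` masses of
the two solutions `Ai (e^{∓iα} w_x)` on the half lines. No asymptotic expansion of the Airy function
is used; energy identities suffice.

Write `λ = l + i η` and `y t = Ai (e^{-iα} (l + i t))`, so that `y'' = -(l + i t) y`, and
`Ai (e^{iα} (l + i t))` is the conjugate of `y (-t)`. The contour representation shows that `y` and
`y'` are bounded for `t ≥ 0`, uniformly for `0 ≤ l ≤ L` (`exists_bound_airyLine`). The flux
`Φ = y' ȳ` has derivative `|y'|² - (l + i t) |y|²`; boundedness makes `t |y|²` and `|y'|²`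
integrable at `+∞`, so that `Φ` tends to `0` there and, for every real `a`,
`-Φ(a) = ∫ |y'|² - l ∫ |y|² - i ∫ t |y|²` with all integrals over `(a, ∞)`.

Let `X a = ∫ |y|²` over `(a, ∞)`. At a point `a` with `|Im Φ(a)| ≥ (2 L + k²) X a`, this identity
and `k |y a|² ≤ k² X a + ∫ |y'|²` give `k |y| ≤ 2 |y'|`, `k² X ≤ 2 |y'| |y|`, and they confine `Φ(a)`
to a cone of opening less than `π` (`IsRecessive.estimates_of_tailMass_le`). The hypothesis holds at
`a = η` for large `η`, since `Im Φ(η) = ∫ t |y|² ≥ η X η`. It also holds at `a = -η`, because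
`X (-η)` tends to infinity uniformly in `l` (`IsRecessive.lt_tailMass_neg`): the Wronskian is
constant and nonzero, which bounds `|y|² + |y'|²` from below on the negative half line.

The two cones are such that the terms of the Wronskian
`W = y'(η) \bar{y(-η)} + \bar{y'(-η)} y(η)` cannot cancel, so that `|y'(η) y(-η)|` and
`|y'(-η) y(η)|` are at most `6 |W|` (`norm_add_norm_le_of_flux`). Consequently
`|f(λ)| = 2 π |y'(η) y'(-η)| ≥ π k |W| / 2` exceeds `2 κ` for large `k`, and the products of
coefficients and masses in the norm of the kernel are all `O(|W| / k²)`
(`IsRecessive.estimates_of_large`, `normG₁_le`). Here `k` may be taken as large as desired, and the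
estimates are symmetric under `η ↦ -η`.
-/

/-! ### Moments of the contour integral -/

/-- The integral over the ray `t = r c` of `r ^ n e ^ {-r ^ 3 / 3 - z t}` against `dr`. The Airy
function and its derivatives are combinations of these with `c = e ^ {± i π / 3}`. -/
noncomputable def rayMoment (n : ℕ) (c z : ℂ) : ℂ :=
  ∫ r in Set.Ioi (0 : ℝ),
    (r : ℂ) ^ n * Complex.exp (-(r : ℂ) ^ 3 / 3) * Complex.exp (-(z * (r * c)))

/-- The real integral that dominates `rayMoment n c z` when `-Re (z c) ≤ M`. -/
noncomputable def rayMajorant (n : ℕ) (M : ℝ) : ℝ :=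
  ∫ r in Set.Ioi (0 : ℝ), r ^ n * Real.exp (-r ^ 3 / 3) * Real.exp (M * r)

lemma integrableOn_rayMajorant (n : ℕ) (M : ℝ) :
    IntegrableOn (fun r : ℝ => r ^ n * Real.exp (-r ^ 3 / 3) * Real.exp (M * r)) (Set.Ioi 0) := by
  have hG := (Real.GammaIntegral_convergent (s := n + 1) (by positivity)).const_mul
    (Real.exp (2 / 3 * (|M| + 1) ^ 3))
  refine Integrable.mono' hG (by fun_prop) ?_
  filter_upwards [ae_restrict_mem measurableSet_Ioi] with r hr
  have hr0 : 0 < r := hr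
  rw [Real.norm_of_nonneg (by positivity), add_sub_cancel_right, Real.rpow_natCast,
    mul_comm (Real.exp (-r)), ← mul_assoc, mul_comm (Real.exp _) (r ^ n), mul_assoc, mul_assoc,
    ← Real.exp_add, ← Real.exp_add]
  refine mul_le_mul_of_nonneg_left (Real.exp_le_exp.mpr ?_) (by positivity)
  -- the tangent line of `r ^ 3` at `a = |M| + 1`
  have ha : 0 ≤ |M| := abs_nonneg M
  have h1 : 0 ≤ (r - (|M| + 1)) ^ 2 * (r + 2 * (|M| + 1)) := by positivity
  have h2 : M * r ≤ |M| * r := mul_le_mul_of_nonneg_right (le_abs_self M) hr0.le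
  have h3 : 0 ≤ |M| * r := by positivity
  have h4 : 0 ≤ |M| ^ 2 * r := by positivity
  nlinarith

lemma norm_rayMoment_integrand_le {n : ℕ} {c z : ℂ} {M r : ℝ} (hM : -(z * c).re ≤ M)
    (hr : 0 < r) :
    ‖(r : ℂ) ^ n * Complex.exp (-(r : ℂ) ^ 3 / 3) * Complex.exp (-(z * (r * c)))‖ ≤
      r ^ n * Real.exp (-r ^ 3 / 3) * Real.exp (M * r) := by
  have h1 : (-(r : ℂ) ^ 3 / 3).re = -r ^ 3 / 3 := by
    rw [show (-(r : ℂ) ^ 3 / 3) = ((-r ^ 3 / 3 : ℝ) : ℂ) by push_cast; ring, Complex.ofReal_re]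
  have h2 : (-(z * (r * c))).re = -(z * c).re * r := by
    rw [show -(z * (r * c)) = ((-r : ℝ) : ℂ) * (z * c) by push_cast; ring, Complex.re_ofReal_mul]
    ring
  rw [norm_mul, norm_mul, Complex.norm_exp, Complex.norm_exp, h1, h2, norm_pow, Complex.norm_real,
    Real.norm_of_nonneg hr.le]
  gcongr

lemma integrableOn_rayMoment (n : ℕ) (c z : ℂ) :
    IntegrableOn (fun r : ℝ => (r : ℂ) ^ n * Complex.exp (-(r : ℂ) ^ 3 / 3) *
      Complex.exp (-(z * (r * c)))) (Set.Ioi 0) := by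
  refine Integrable.mono' (integrableOn_rayMajorant n (-(z * c).re))
    (Continuous.aestronglyMeasurable (by fun_prop)) ?_
  filter_upwards [ae_restrict_mem measurableSet_Ioi] with r hr
  exact norm_rayMoment_integrand_le le_rfl hr

lemma norm_rayMoment_le {n : ℕ} {c z : ℂ} {M : ℝ} (hM : -(z * c).re ≤ M) :
    ‖rayMoment n c z‖ ≤ rayMajorant n M := by
  refine norm_integral_le_of_norm_le (integrableOn_rayMajorant n M) ?_
  filter_upwards [ae_restrict_mem measurableSet_Ioi] with r hr
  exact norm_rayMoment_integrand_le hM hr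

lemma hasDerivAt_rayMoment (n : ℕ) (c z : ℂ) :
    HasDerivAt (rayMoment n c) (-c * rayMoment (n + 1) c z) z := by
  have key := hasDerivAt_integral_of_dominated_loc_of_deriv_le
    (μ := volume.restrict (Set.Ioi (0 : ℝ)))
    (F := fun (z : ℂ) (r : ℝ) => (r : ℂ) ^ n * Complex.exp (-(r : ℂ) ^ 3 / 3) *
      Complex.exp (-(z * (r * c))))
    (F' := fun (z : ℂ) (r : ℝ) => -c * ((r : ℂ) ^ (n + 1) * Complex.exp (-(r : ℂ) ^ 3 / 3) *
      Complex.exp (-(z * (r * c)))))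
    (bound := fun r => ‖c‖ * (r ^ (n + 1) * Real.exp (-r ^ 3 / 3) *
      Real.exp ((‖z‖ + 1) * ‖c‖ * r)))
    (x₀ := z) (s := Metric.ball z 1) (Metric.ball_mem_nhds z one_pos)
    (Eventually.of_forall fun w => (integrableOn_rayMoment n c w).aestronglyMeasurable)
    (integrableOn_rayMoment n c z)
    ((integrableOn_rayMoment (n + 1) c z).aestronglyMeasurable.const_mul _) ?_
    ((integrableOn_rayMajorant (n + 1) _).const_mul _) ?_
  · have h := key.2
    rw [integral_const_mul] at h
    exact h
  · filter_upwards [ae_restrict_mem measurableSet_Ioi] with r hr w hw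
    rw [norm_mul, norm_neg]
    refine mul_le_mul_of_nonneg_left (norm_rayMoment_integrand_le ?_ hr) (norm_nonneg _)
    have h1 : ‖w‖ ≤ ‖z‖ + 1 := by
      have := norm_le_norm_add_norm_sub z w
      rw [Metric.mem_ball, dist_eq_norm] at hw
      rw [norm_sub_rev] at hw
      linarith
    calc -(w * c).re ≤ |(w * c).re| := neg_le_abs _
      _ ≤ ‖w * c‖ := Complex.abs_re_le_norm _
      _ = ‖w‖ * ‖c‖ := norm_mul _ _
      _ ≤ (‖z‖ + 1) * ‖c‖ := by gcongr
  · refine Eventually.of_forall fun r w _ => ?_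
    have h1 : HasDerivAt (fun w : ℂ => -(w * (r * c))) (-(r * c)) w := by
      simpa using ((hasDerivAt_id w).mul_const ((r : ℂ) * c)).fun_neg
    refine (h1.cexp.const_mul ((r : ℂ) ^ n * Complex.exp (-(r : ℂ) ^ 3 / 3))).congr_deriv ?_
    ring

/-- If `c ^ 3 = -1`, then `c ^ 3 r ^ 2 - c z` is the derivative of the exponent `-r ^ 3 / 3 - z r c`.
The combined integrand is therefore exact, and only the endpoint `r = 0` contributes. Since the
contribution does not depend on `c`, it cancels between the two rays of the contour. -/
lemma rayMoment_two_sub {c : ℂ} (hc : c ^ 3 = -1) (z : ℂ) :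
    c ^ 3 * rayMoment 2 c z - c * z * rayMoment 0 c z = -1 := by
  have hd : ∀ r : ℝ, HasDerivAt
      (fun r : ℝ => Complex.exp (-(r : ℂ) ^ 3 / 3) * Complex.exp (-(z * (r * c))))
      (c ^ 3 * ((r : ℂ) ^ 2 * Complex.exp (-(r : ℂ) ^ 3 / 3) * Complex.exp (-(z * (r * c)))) -
        c * z * ((r : ℂ) ^ 0 * Complex.exp (-(r : ℂ) ^ 3 / 3) *
          Complex.exp (-(z * (r * c))))) r := by
    intro r
    have h0 : HasDerivAt (fun r : ℝ => (r : ℂ)) 1 r := Complex.ofRealCLM.hasDerivAt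
    have h1 : HasDerivAt (fun r : ℝ => -(r : ℂ) ^ 3 / 3) (-(r : ℂ) ^ 2) r := by
      refine ((h0.fun_pow 3).fun_neg.div_const 3).congr_deriv ?_
      ring
    have h2 : HasDerivAt (fun r : ℝ => -(z * (r * c))) (-(z * c)) r := by
      refine ((h0.mul_const c).const_mul z).fun_neg.congr_deriv ?_
      ring
    refine (h1.cexp.mul h2.cexp).congr_deriv ?_
    rw [hc]
    ring
  have h2 := integrableOn_rayMoment 2 c z
  have h0 := integrableOn_rayMoment 0 c z
  have hi := (h2.const_mul (c ^ 3)).sub (h0.const_mul (c * z))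
  have hlim := tendsto_zero_of_hasDerivAt_of_integrableOn_Ioi (a := 0) (fun r _ => hd r) hi
    (by simpa using h0)
  have := integral_Ioi_of_hasDerivAt_of_tendsto' (a := 0) (fun r _ => hd r) hi hlim
  rw [integral_sub (h2.const_mul (c ^ 3)) (h0.const_mul (c * z)), integral_const_mul,
    integral_const_mul] at this
  unfold rayMoment
  rw [this]
  simp

/-! ### The Airy function -/

/-- `e ^ {i π / 3}`, the direction of the outgoing ray of the contour. -/
noncomputable def rayDir : ℂ := Complex.exp (Real.pi / 3 * Complex.I)

lemma exp_neg_pi_div_three : Complex.exp (-(Real.pi / 3 * Complex.I)) = starRingEnd ℂ rayDir := by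
  rw [rayDir, ← Complex.exp_conj]
  congr 1
  simp [map_ofNat]

lemma rayDir_eq : rayDir = ⟨1 / 2, √3 / 2⟩ := by
  rw [rayDir, show (Real.pi / 3 * Complex.I : ℂ) = ((Real.pi / 3 : ℝ) : ℂ) * Complex.I by
    push_cast; rfl]
  apply Complex.ext
  · rw [Complex.exp_ofReal_mul_I_re, Real.cos_pi_div_three]
  · rw [Complex.exp_ofReal_mul_I_im, Real.sin_pi_div_three]

lemma rayDir_pow_three : rayDir ^ 3 = -1 := by
  rw [rayDir, ← Complex.exp_nat_mul, ← Complex.exp_pi_mul_I]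
  congr 1
  push_cast
  ring

lemma conj_rayDir_pow_three : (starRingEnd ℂ rayDir) ^ 3 = -1 := by
  rw [← map_pow, rayDir_pow_three]
  simp

lemma rotPos_eq : rotPos = rayDir ^ 2 := by
  rw [rotPos, rayDir, ← Complex.exp_nat_mul]
  congr 1
  push_cast
  ring

lemma conj_rotNeg : starRingEnd ℂ rotNeg = rotPos := by
  rw [rotNeg, rotPos, ← Complex.exp_conj]
  congr 1
  simp [map_ofNat]

lemma conj_rotPos : starRingEnd ℂ rotPos = rotNeg := by
  rw [← conj_rotNeg, Complex.conj_conj]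

lemma rayDir_mul_conj : rayDir * starRingEnd ℂ rayDir = 1 := by
  rw [← exp_neg_pi_div_three, rayDir, ← Complex.exp_add]
  simp

lemma rotNeg_eq : rotNeg = (starRingEnd ℂ rayDir) ^ 2 := by
  rw [← conj_rotPos, rotPos_eq, map_pow]

lemma rotPos_pow_three : rotPos ^ 3 = 1 := by
  rw [rotPos_eq, ← pow_mul, mul_comm, pow_mul, rayDir_pow_three]
  norm_num

lemma rotNeg_pow_three : rotNeg ^ 3 = 1 := by
  rw [← conj_rotPos, ← map_pow, rotPos_pow_three, map_one]

lemma norm_rotNeg : ‖rotNeg‖ = 1 :=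
  (pow_eq_one_iff_of_nonneg (norm_nonneg _) three_ne_zero).mp
    (by rw [← norm_pow, rotNeg_pow_three, norm_one])

lemma norm_rotPos : ‖rotPos‖ = 1 := by
  rw [← conj_rotNeg, Complex.norm_conj, norm_rotNeg]

lemma airyAi_eq (z : ℂ) :
    airyAi z = 1 / (2 * Real.pi * Complex.I) * (rayDir * rayMoment 0 rayDir z -
      starRingEnd ℂ rayDir * rayMoment 0 (starRingEnd ℂ rayDir) z) := by
  unfold airyAi rayMoment
  rw [← integral_const_mul rayDir, ← integral_const_mul (starRingEnd ℂ rayDir),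
    ← integral_sub ((integrableOn_rayMoment 0 _ z).const_mul _)
      ((integrableOn_rayMoment 0 _ z).const_mul _), exp_neg_pi_div_three, ← rayDir]
  congr 2
  funext r
  ring

lemma hasDerivAt_airyAi_aux (z : ℂ) :
    HasDerivAt airyAi (1 / (2 * Real.pi * Complex.I) * (-rayDir ^ 2 * rayMoment 1 rayDir z +
      (starRingEnd ℂ rayDir) ^ 2 * rayMoment 1 (starRingEnd ℂ rayDir) z)) z := by
  rw [show airyAi = _ from funext airyAi_eq]
  refine (((((hasDerivAt_rayMoment 0 rayDir z).const_mul rayDir).sub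
    ((hasDerivAt_rayMoment 0 (starRingEnd ℂ rayDir) z).const_mul (starRingEnd ℂ rayDir))).const_mul
      (1 / (2 * Real.pi * Complex.I) : ℂ))).congr_deriv ?_
  ring

lemma airyAiDeriv_eq (z : ℂ) :
    airyAiDeriv z = 1 / (2 * Real.pi * Complex.I) * (-rayDir ^ 2 * rayMoment 1 rayDir z +
      (starRingEnd ℂ rayDir) ^ 2 * rayMoment 1 (starRingEnd ℂ rayDir) z) :=
  (hasDerivAt_airyAi_aux z).deriv

lemma hasDerivAt_airyAi (z : ℂ) : HasDerivAt airyAi (airyAiDeriv z) z :=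
  (hasDerivAt_airyAi_aux z).differentiableAt.hasDerivAt

/-- Airy's equation `Ai'' = z Ai`. -/
lemma hasDerivAt_airyAiDeriv (z : ℂ) : HasDerivAt airyAiDeriv (z * airyAi z) z := by
  rw [show airyAiDeriv = _ from funext airyAiDeriv_eq]
  refine (((((hasDerivAt_rayMoment 1 rayDir z).const_mul (-rayDir ^ 2)).add
    ((hasDerivAt_rayMoment 1 (starRingEnd ℂ rayDir) z).const_mul
      ((starRingEnd ℂ rayDir) ^ 2))).const_mul (1 / (2 * Real.pi * Complex.I) : ℂ))).congr_deriv ?_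
  rw [airyAi_eq]
  linear_combination (1 / (2 * Real.pi * Complex.I) : ℂ) *
    (rayMoment_two_sub rayDir_pow_three z - rayMoment_two_sub conj_rayDir_pow_three z)

lemma rayMoment_conj (n : ℕ) (c z : ℂ) :
    rayMoment n (starRingEnd ℂ c) (starRingEnd ℂ z) = starRingEnd ℂ (rayMoment n c z) := by
  unfold rayMoment
  rw [← integral_conj]
  congr 1
  funext r
  simp [← Complex.exp_conj, map_ofNat]

lemma airyAi_conj (z : ℂ) : airyAi (starRingEnd ℂ z) = starRingEnd ℂ (airyAi z) := by
  have h := rayMoment_conj 0 (starRingEnd ℂ rayDir) z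
  rw [Complex.conj_conj] at h
  rw [airyAi_eq, airyAi_eq, rayMoment_conj, h]
  simp [map_ofNat]
  ring

lemma airyAiDeriv_conj (z : ℂ) :
    airyAiDeriv (starRingEnd ℂ z) = starRingEnd ℂ (airyAiDeriv z) := by
  have h := rayMoment_conj 1 (starRingEnd ℂ rayDir) z
  rw [Complex.conj_conj] at h
  rw [airyAiDeriv_eq, airyAiDeriv_eq, rayMoment_conj, h]
  simp [map_ofNat]
  ring

lemma rayMoment_zero_right (n : ℕ) (c : ℂ) : rayMoment n c 0 = rayMajorant n 0 := by
  unfold rayMoment rayMajorant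
  rw [← integral_complex_ofReal]
  congr 1
  funext r
  simp

lemma rayMajorant_pos (n : ℕ) (M : ℝ) : 0 < rayMajorant n M := by
  unfold rayMajorant
  rw [setIntegral_pos_iff_support_of_nonneg_ae _ (integrableOn_rayMajorant n M)]
  · refine lt_of_lt_of_le ?_ (measure_mono (s := Set.Ioi (0 : ℝ)) fun r hr => ⟨?_, hr⟩)
    · simp
    · have hr0 : 0 < r := hr
      rw [Function.mem_support]
      positivity
  · filter_upwards [ae_restrict_mem measurableSet_Ioi] with r hr
    have hr0 : 0 < r := hr
    simp only [Pi.zero_apply]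
    positivity

lemma airyAi_zero_ne_zero : airyAi 0 ≠ 0 := by
  rw [airyAi_eq, rayMoment_zero_right, rayMoment_zero_right, ← sub_mul]
  refine mul_ne_zero (by simp [Real.pi_ne_zero]) (mul_ne_zero ?_ ?_)
  · intro h
    have := congrArg Complex.im h
    simp [rayDir_eq] at this
  · exact_mod_cast (rayMajorant_pos 0 0).ne'

lemma airyAiDeriv_zero_ne_zero : airyAiDeriv 0 ≠ 0 := by
  rw [airyAiDeriv_eq, rayMoment_zero_right, rayMoment_zero_right, ← add_mul]
  refine mul_ne_zero (by simp [Real.pi_ne_zero]) (mul_ne_zero ?_ ?_)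
  · intro h
    have := congrArg Complex.im h
    simp [rayDir_eq, pow_two] at this
    have h3 : (0 : ℝ) < √3 := by positivity
    linarith
  · exact_mod_cast (rayMajorant_pos 1 0).ne'

/-- The Wronskian of the solutions `Ai (e^{iα} w)` and `Ai (e^{-iα} w)` of `u'' = w u`. -/
noncomputable def airyWronskian (w : ℂ) : ℂ :=
  rotNeg * airyAiDeriv (rotNeg * w) * airyAi (rotPos * w) -
    rotPos * airyAiDeriv (rotPos * w) * airyAi (rotNeg * w)

lemma airyWronskian_eq (w : ℂ) : airyWronskian w = airyWronskian 0 := by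
  have hd : ∀ w, HasDerivAt airyWronskian 0 w := by
    intro w
    have hA : ∀ ρ : ℂ, HasDerivAt (fun w => airyAi (ρ * w)) (airyAiDeriv (ρ * w) * ρ) w := fun ρ =>
      (hasDerivAt_airyAi (ρ * w)).comp w (by simpa using (hasDerivAt_id w).const_mul ρ)
    have hB : ∀ ρ : ℂ, HasDerivAt (fun w => airyAiDeriv (ρ * w))
        (ρ * w * airyAi (ρ * w) * ρ) w := fun ρ =>
      (hasDerivAt_airyAiDeriv (ρ * w)).comp w (by simpa using (hasDerivAt_id w).const_mul ρ)
    refine ((((hB rotNeg).const_mul rotNeg).mul (hA rotPos)).sub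
      (((hB rotPos).const_mul rotPos).mul (hA rotNeg))).congr_deriv ?_
    linear_combination (airyAi (rotNeg * w) * airyAi (rotPos * w) * w) *
      (rotNeg_pow_three - rotPos_pow_three)
  exact is_const_of_deriv_eq_zero (fun w => (hd w).differentiableAt) (fun w => (hd w).deriv) w 0

lemma airyWronskian_zero_ne_zero : airyWronskian 0 ≠ 0 := by
  have h : airyWronskian 0 = (rotNeg - rotPos) * (airyAiDeriv 0 * airyAi 0) := by
    simp only [airyWronskian, mul_zero]
    ring
  rw [h]
  refine mul_ne_zero ?_ (mul_ne_zero airyAiDeriv_zero_ne_zero airyAi_zero_ne_zero)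
  intro h
  have := congrArg Complex.im h
  simp [rotNeg_eq, rotPos_eq, rayDir_eq, pow_two] at this
  have h3 : (0 : ℝ) < √3 := by positivity
  linarith

/-! ### The Airy function along a vertical line -/

/-- The solution `t ↦ Ai (e^{-iα} (l + i t))` of `y'' = -(l + i t) y`, recessive as `t → +∞`. -/
noncomputable def airyLine (l t : ℝ) : ℂ := airyAi (rotNeg * (l + Complex.I * t))

/-- The derivative of `airyLine l`. -/
noncomputable def airyLineDeriv (l t : ℝ) : ℂ :=
  Complex.I * rotNeg * airyAiDeriv (rotNeg * (l + Complex.I * t))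

lemma hasDerivAt_vertical (l t : ℝ) : HasDerivAt
    (fun t : ℝ => rotNeg * (l + Complex.I * t)) (Complex.I * rotNeg) t := by
  have h0 : HasDerivAt (fun r : ℝ => (r : ℂ)) 1 t := Complex.ofRealCLM.hasDerivAt
  refine (((h0.const_mul Complex.I).const_add (l : ℂ)).const_mul rotNeg).congr_deriv ?_
  ring

lemma hasDerivAt_airyLine (l t : ℝ) : HasDerivAt (airyLine l) (airyLineDeriv l t) t := by
  refine ((hasDerivAt_airyAi _).comp t (hasDerivAt_vertical l t)).congr_deriv ?_
  unfold airyLineDeriv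
  ring

lemma hasDerivAt_airyLineDeriv (l t : ℝ) :
    HasDerivAt (airyLineDeriv l) (-(l + Complex.I * t) * airyLine l t) t := by
  refine (((hasDerivAt_airyAiDeriv _).comp t (hasDerivAt_vertical l t)).const_mul
    (Complex.I * rotNeg)).congr_deriv ?_
  unfold airyLine
  linear_combination ((l + Complex.I * t) * airyAi (rotNeg * (l + Complex.I * t))) *
    (Complex.I ^ 2 * rotNeg_pow_three + Complex.I_sq)

lemma conj_airyLine_neg (l t : ℝ) :
    starRingEnd ℂ (airyLine l (-t)) = airyAi (rotPos * (l + Complex.I * t)) := by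
  rw [airyLine, ← airyAi_conj]
  simp [conj_rotNeg]

lemma conj_airyLineDeriv_neg (l t : ℝ) : starRingEnd ℂ (airyLineDeriv l (-t)) =
    -(Complex.I * rotPos * airyAiDeriv (rotPos * (l + Complex.I * t))) := by
  rw [airyLineDeriv, map_mul, ← airyAiDeriv_conj]
  simp [conj_rotNeg]

lemma norm_airyLine_wronskian (l t : ℝ) :
    ‖airyLineDeriv l t * starRingEnd ℂ (airyLine l (-t)) +
      starRingEnd ℂ (airyLineDeriv l (-t)) * airyLine l t‖ = ‖airyWronskian 0‖ := by
  rw [conj_airyLine_neg, conj_airyLineDeriv_neg, ← airyWronskian_eq (l + Complex.I * t),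
    ← one_mul ‖airyWronskian _‖, ← Complex.norm_I, ← norm_mul]
  congr 1
  unfold airyLineDeriv airyLine airyWronskian
  ring

/-- A bound of `Ai (e^{-iα} w)` and its derivative that is uniform over `t ≥ -S` and `0 ≤ l ≤ L`.
The exponent `-e^{-iα} w r e^{±iπ/3}` on the two rays of the contour equals `-w r e^{-iπ/3}` and
`w r`, whose real parts are bounded above by `S r` and by `L r`. -/
lemma exists_bound_airyLine (L S : ℝ) (hS : 0 ≤ S) : ∃ B : ℝ, ∀ l t : ℝ, 0 ≤ l → l ≤ L → -S ≤ t →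
    ‖airyLine l t‖ ≤ B ∧ ‖airyLineDeriv l t‖ ≤ B := by
  have hn : ‖rayDir‖ = 1 :=
    (pow_eq_one_iff_of_nonneg (norm_nonneg _) three_ne_zero).mp
      (by rw [← norm_pow, rayDir_pow_three, norm_neg, norm_one])
  have hpi : ‖(1 / (2 * Real.pi * Complex.I) : ℂ)‖ ≤ 1 := by
    have := Real.pi_gt_three
    simp only [norm_div, norm_one, norm_mul, Complex.norm_ofNat, Complex.norm_real, Complex.norm_I,
      Real.norm_of_nonneg Real.pi_pos.le]
    rw [div_le_one (by positivity)]
    linarith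
  refine ⟨max (2 * rayMajorant 0 (L + S)) (2 * rayMajorant 1 (L + S)), fun l t hl hlL ht => ?_⟩
  have e1 : -(rotNeg * (l + Complex.I * t) * rayDir).re ≤ L + S := by
    rw [show rotNeg * (l + Complex.I * t) * rayDir = (l + Complex.I * t) * starRingEnd ℂ rayDir by
      rw [rotNeg_eq]
      linear_combination ((l + Complex.I * t) * starRingEnd ℂ rayDir) * rayDir_mul_conj]
    have h3 : √3 ≤ 2 := Real.sqrt_le_iff.mpr (by norm_num)
    have h30 : 0 ≤ √3 := Real.sqrt_nonneg 3
    simp [rayDir_eq]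
    nlinarith
  have e2 : -(rotNeg * (l + Complex.I * t) * starRingEnd ℂ rayDir).re ≤ L + S := by
    rw [show rotNeg * (l + Complex.I * t) * starRingEnd ℂ rayDir = -(l + Complex.I * t) by
      rw [rotNeg_eq]
      linear_combination (l + Complex.I * t) * conj_rayDir_pow_three]
    simp
    linarith
  constructor
  · refine le_trans ?_ (le_max_left _ _)
    rw [airyLine, airyAi_eq, norm_mul]
    refine (mul_le_of_le_one_left (norm_nonneg _) hpi).trans ((norm_sub_le _ _).trans ?_)
    rw [norm_mul, norm_mul, Complex.norm_conj, hn]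
    have := norm_rayMoment_le (n := 0) e1
    have := norm_rayMoment_le (n := 0) e2
    linarith
  · refine le_trans ?_ (le_max_right _ _)
    rw [airyLineDeriv, airyAiDeriv_eq, norm_mul, norm_mul, norm_mul, Complex.norm_I, norm_rotNeg,
      mul_one, one_mul]
    refine (mul_le_of_le_one_left (norm_nonneg _) hpi).trans ((norm_add_le _ _).trans ?_)
    rw [norm_mul, norm_mul, norm_neg, norm_pow, norm_pow, Complex.norm_conj, hn]
    have := norm_rayMoment_le (n := 1) e1
    have := norm_rayMoment_le (n := 1) e2
    linarith

/-! ### Tail integrals and monotonicity -/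

lemma integrableOn_Ioi_of_continuous {g : ℝ → ℝ} (hg : Continuous g) {b : ℝ}
    (hb : IntegrableOn g (Set.Ioi b)) (a : ℝ) : IntegrableOn g (Set.Ioi a) := by
  refine ((hg.integrableOn_Icc (a := a) (b := b)).union hb).mono_set fun x hx => ?_
  rcases le_or_gt x b with h | h
  · exact Or.inl ⟨le_of_lt hx, h⟩
  · exact Or.inr h

lemma hasDerivAt_integral_Ioi {g : ℝ → ℝ} (hg : Continuous g)
    (hi : ∀ a, IntegrableOn g (Set.Ioi a)) (a : ℝ) :
    HasDerivAt (fun a => ∫ s in Set.Ioi a, g s) (-g a) a := by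
  have h : (fun a => ∫ s in Set.Ioi a, g s) =
      fun a => (∫ s in Set.Ioi 0, g s) - ∫ s in (0 : ℝ)..a, g s := by
    funext b
    rw [← intervalIntegral.integral_Ioi_sub_Ioi' (hi 0) (hi b)]
    ring
  rw [h]
  exact (hg.integral_hasStrictDerivAt 0 a).hasDerivAt.const_sub _

lemma le_of_hasDerivAt_nonneg {f f' : ℝ → ℝ} (hf : ∀ x, HasDerivAt f (f' x) x) {a b : ℝ}
    (hab : a ≤ b) (h0 : ∀ x ∈ Set.Icc a b, 0 ≤ f' x) : f a ≤ f b := by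
  refine monotoneOn_of_deriv_nonneg (convex_Icc a b)
    (fun x _ => (hf x).continuousAt.continuousWithinAt)
    (fun x _ => (hf x).differentiableAt.differentiableWithinAt) (fun x hx => ?_)
    (Set.left_mem_Icc.mpr hab) (Set.right_mem_Icc.mpr hab) hab
  rw [(hf x).deriv]
  exact h0 x (interior_subset hx)

/-- A nonnegative continuous derivative of a function bounded on `[0, ∞)` is integrable there. -/
lemma integrableOn_Ioi_of_bounded_primitive {f f' : ℝ → ℝ} (hf : ∀ x, HasDerivAt f (f' x) x)
    (hc : Continuous f') (h0 : ∀ x, 0 ≤ x → 0 ≤ f' x) {C : ℝ} (hC : ∀ x, 0 ≤ x → |f x| ≤ C)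
    (a : ℝ) : IntegrableOn f' (Set.Ioi a) := by
  refine integrableOn_Ioi_of_continuous hc (b := 0) ?_ a
  refine integrableOn_Ioi_of_intervalIntegral_norm_bounded (l := atTop) (b := id) (2 * C) 0
    (fun i => hc.integrableOn_Ioc) tendsto_id ?_
  filter_upwards [eventually_ge_atTop 0] with T hT
  have h1 : ∫ x in (0 : ℝ)..T, ‖f' x‖ = ∫ x in (0 : ℝ)..T, f' x := by
    refine intervalIntegral.integral_congr fun x hx => ?_
    rw [Set.uIcc_of_le hT] at hx
    exact Real.norm_of_nonneg (h0 x hx.1)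
  rw [id, h1, intervalIntegral.integral_eq_sub_of_hasDerivAt (fun x _ => hf x)
    (hc.intervalIntegrable _ _)]
  have := abs_le.mp (hC T hT)
  have := abs_le.mp (hC 0 le_rfl)
  linarith

/-! ### Energy identities for the recessive solution -/

/-- `y` is a solution of `y'' = -(l + i t) y` with derivative `dy`, and both are bounded by `B` for
`t ≥ 0`. This bound already forces `y` to be square integrable at `+∞`. -/
structure IsRecessive (l B : ℝ) (y dy : ℝ → ℂ) : Prop where
  hasDerivAt : ∀ t, HasDerivAt y (dy t) t
  hasDerivAt_deriv : ∀ t, HasDerivAt dy (-(l + Complex.I * t) * y t) t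
  norm_le : ∀ t, 0 ≤ t → ‖y t‖ ≤ B
  norm_deriv_le : ∀ t, 0 ≤ t → ‖dy t‖ ≤ B

/-- The flux `y' ȳ`, whose derivative is `|y'| ^ 2 - (l + i t) |y| ^ 2`. -/
noncomputable def flux (y dy : ℝ → ℂ) (t : ℝ) : ℂ := dy t * starRingEnd ℂ (y t)

/-- The integral of `|y| ^ 2` over `(a, ∞)`. -/
noncomputable def tailMass (y : ℝ → ℂ) (a : ℝ) : ℝ := ∫ s in Set.Ioi a, ‖y s‖ ^ 2

lemma tailMass_nonneg (y : ℝ → ℂ) (a : ℝ) : 0 ≤ tailMass y a :=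
  integral_nonneg fun _ => by positivity

lemma norm_flux (y dy : ℝ → ℂ) (t : ℝ) : ‖flux y dy t‖ = ‖dy t‖ * ‖y t‖ := by
  rw [flux, norm_mul, Complex.norm_conj]

namespace IsRecessive

variable {l B : ℝ} {y dy : ℝ → ℂ}

lemma bound_nonneg (h : IsRecessive l B y dy) : 0 ≤ B :=
  (norm_nonneg _).trans (h.norm_le 0 le_rfl)

lemma continuous (h : IsRecessive l B y dy) : Continuous y :=
  continuous_iff_continuousAt.mpr fun t => (h.hasDerivAt t).continuousAt

lemma continuous_deriv (h : IsRecessive l B y dy) : Continuous dy :=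
  continuous_iff_continuousAt.mpr fun t => (h.hasDerivAt_deriv t).continuousAt

lemma hasDerivAt_flux (h : IsRecessive l B y dy) (t : ℝ) : HasDerivAt (flux y dy)
    ((‖dy t‖ ^ 2 : ℝ) - (l + Complex.I * t) * (‖y t‖ ^ 2 : ℝ)) t := by
  refine ((h.hasDerivAt_deriv t).mul (h.hasDerivAt t).star).congr_deriv ?_
  have e1 := Complex.mul_conj' (dy t)
  have e2 := Complex.mul_conj' (y t)
  simp only [Complex.star_def, Complex.ofReal_pow]
  linear_combination e1 - (l + Complex.I * t) * e2

lemma hasDerivAt_flux_re (h : IsRecessive l B y dy) (t : ℝ) :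
    HasDerivAt (fun t => (flux y dy t).re) (‖dy t‖ ^ 2 - l * ‖y t‖ ^ 2) t := by
  refine (Complex.reCLM.hasFDerivAt.comp_hasDerivAt t (h.hasDerivAt_flux t)).congr_deriv ?_
  rw [Complex.reCLM_apply, Complex.sub_re, Complex.ofReal_re, Complex.re_mul_ofReal]
  simp

lemma hasDerivAt_flux_im (h : IsRecessive l B y dy) (t : ℝ) :
    HasDerivAt (fun t => (flux y dy t).im) (-(t * ‖y t‖ ^ 2)) t := by
  refine (Complex.imCLM.hasFDerivAt.comp_hasDerivAt t (h.hasDerivAt_flux t)).congr_deriv ?_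
  rw [Complex.imCLM_apply, Complex.sub_im, Complex.ofReal_im, Complex.im_mul_ofReal]
  simp

lemma hasDerivAt_norm_sq (h : IsRecessive l B y dy) (t : ℝ) :
    HasDerivAt (fun t => ‖y t‖ ^ 2) (2 * (flux y dy t).re) t := by
  refine (h.hasDerivAt t).norm_sq.congr_deriv ?_
  rw [Complex.inner, flux, mul_comm]

lemma norm_flux_le (h : IsRecessive l B y dy) {t : ℝ} (ht : 0 ≤ t) : ‖flux y dy t‖ ≤ B ^ 2 := by
  rw [norm_flux, sq]
  exact mul_le_mul (h.norm_deriv_le t ht) (h.norm_le t ht) (norm_nonneg _) h.bound_nonneg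

lemma integrableOn_mul_norm_sq (h : IsRecessive l B y dy) (a : ℝ) :
    IntegrableOn (fun t => t * ‖y t‖ ^ 2) (Set.Ioi a) := by
  have hc := h.continuous
  refine integrableOn_Ioi_of_bounded_primitive (f := fun t => -(flux y dy t).im) (C := B ^ 2)
    (fun t => ?_) (by fun_prop) (fun t ht => by positivity) (fun t ht => ?_) a
  · exact (h.hasDerivAt_flux_im t).fun_neg.congr_deriv (neg_neg _)
  · rw [abs_neg]
    exact (Complex.abs_im_le_norm _).trans (h.norm_flux_le ht)

lemma integrableOn_norm_sq (h : IsRecessive l B y dy) (a : ℝ) :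
    IntegrableOn (fun t => ‖y t‖ ^ 2) (Set.Ioi a) := by
  have hc := h.continuous
  refine integrableOn_Ioi_of_continuous (by fun_prop) (b := 1) ?_ a
  refine Integrable.mono' (h.integrableOn_mul_norm_sq 1)
    (Continuous.aestronglyMeasurable (by fun_prop)) ?_
  filter_upwards [ae_restrict_mem measurableSet_Ioi] with t ht
  rw [Real.norm_of_nonneg (by positivity)]
  exact le_mul_of_one_le_left (by positivity) (le_of_lt ht)

lemma hasDerivAt_tailMass (h : IsRecessive l B y dy) (a : ℝ) :
    HasDerivAt (tailMass y) (-‖y a‖ ^ 2) a := by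
  have hc := h.continuous
  exact hasDerivAt_integral_Ioi (g := fun t => ‖y t‖ ^ 2) (by fun_prop) h.integrableOn_norm_sq a

lemma tailMass_le_of_le (h : IsRecessive l B y dy) {a b : ℝ} (hab : a ≤ b) :
    tailMass y b ≤ tailMass y a := by
  refine neg_le_neg_iff.mp (le_of_hasDerivAt_nonneg (f := fun a => -tailMass y a)
    (fun x => (h.hasDerivAt_tailMass x).fun_neg) hab fun x _ => ?_)
  rw [neg_neg]
  positivity

lemma integrableOn_norm_deriv_sq (h : IsRecessive l B y dy) (a : ℝ) :
    IntegrableOn (fun t => ‖dy t‖ ^ 2) (Set.Ioi a) := by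
  have hc := h.continuous_deriv
  refine integrableOn_Ioi_of_bounded_primitive
    (f := fun t => (flux y dy t).re - l * tailMass y t) (C := B ^ 2 + |l| * tailMass y 0)
    (fun t => ?_) (by fun_prop) (fun t ht => by positivity) (fun t ht => ?_) a
  · refine ((h.hasDerivAt_flux_re t).sub ((h.hasDerivAt_tailMass t).const_mul l)).congr_deriv ?_
    ring
  · refine (abs_sub _ _).trans (add_le_add ?_ ?_)
    · exact (Complex.abs_re_le_norm _).trans (h.norm_flux_le ht)
    · rw [abs_mul, abs_of_nonneg (tailMass_nonneg y t)]
      exact mul_le_mul_of_nonneg_left (h.tailMass_le_of_le ht) (abs_nonneg l)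

lemma continuous_flux (h : IsRecessive l B y dy) : Continuous (flux y dy) :=
  h.continuous_deriv.mul (Complex.continuous_conj.comp h.continuous)

lemma integrableOn_flux (h : IsRecessive l B y dy) (a : ℝ) :
    IntegrableOn (flux y dy) (Set.Ioi a) := by
  refine Integrable.mono' ((h.integrableOn_norm_sq a).add (h.integrableOn_norm_deriv_sq a))
    h.continuous_flux.aestronglyMeasurable (Eventually.of_forall fun t => ?_)
  rw [norm_flux, Pi.add_apply]
  nlinarith [sq_nonneg (‖dy t‖ - ‖y t‖), sq_nonneg ‖dy t‖, sq_nonneg ‖y t‖]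

lemma integral_mul_norm_sq (h : IsRecessive l B y dy) (a : ℝ) :
    ∫ t in Set.Ioi a, t * ‖y t‖ ^ 2 = (flux y dy a).im := by
  have hi := (h.integrableOn_mul_norm_sq a).neg
  have hlim := tendsto_zero_of_hasDerivAt_of_integrableOn_Ioi
    (fun t _ => h.hasDerivAt_flux_im t) hi (h.integrableOn_flux a).im
  have := integral_Ioi_of_hasDerivAt_of_tendsto' (fun t _ => h.hasDerivAt_flux_im t) hi hlim
  rw [integral_neg] at this
  linarith

lemma integral_norm_deriv_sq (h : IsRecessive l B y dy) (a : ℝ) :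
    ∫ t in Set.Ioi a, ‖dy t‖ ^ 2 = l * tailMass y a - (flux y dy a).re := by
  have h1 := h.integrableOn_norm_deriv_sq a
  have h2 := (h.integrableOn_norm_sq a).const_mul l
  have hi := h1.sub h2
  have hlim := tendsto_zero_of_hasDerivAt_of_integrableOn_Ioi
    (fun t _ => h.hasDerivAt_flux_re t) hi (h.integrableOn_flux a).re
  have := integral_Ioi_of_hasDerivAt_of_tendsto' (fun t _ => h.hasDerivAt_flux_re t) hi hlim
  rw [integral_sub h1 h2, integral_const_mul, ← tailMass.eq_1 y] at this
  linarith

/-- `|y a| ^ 2 = -∫ 2 Re (y' ȳ)` over `(a, ∞)`, combined with `2 k |y'| |y| ≤ k ^ 2 |y| ^ 2 + |y'| ^ 2`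
and the energy identity for `∫ |y'| ^ 2`. -/
lemma norm_sq_le (h : IsRecessive l B y dy) {k : ℝ} (hk : 0 < k) (a : ℝ) :
    k * ‖y a‖ ^ 2 ≤ k ^ 2 * tailMass y a + (l * tailMass y a - (flux y dy a).re) := by
  have hi : IntegrableOn (fun t => 2 * (flux y dy t).re) (Set.Ioi a) :=
    (h.integrableOn_flux a).re.const_mul 2
  have h1 := h.integrableOn_norm_sq a
  have h2 := h.integrableOn_norm_deriv_sq a
  have hlim := tendsto_zero_of_hasDerivAt_of_integrableOn_Ioi
    (fun t _ => h.hasDerivAt_norm_sq t) hi h1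
  have he := integral_Ioi_of_hasDerivAt_of_tendsto' (fun t _ => h.hasDerivAt_norm_sq t) hi hlim
  have hle : ∫ t in Set.Ioi a, -(k * (2 * (flux y dy t).re)) ≤
      ∫ t in Set.Ioi a, (k ^ 2 * ‖y t‖ ^ 2 + ‖dy t‖ ^ 2) := by
    refine integral_mono (hi.const_mul k).neg ((h1.const_mul _).add h2) fun t => ?_
    have e1 := (neg_le_abs _).trans (Complex.abs_re_le_norm (flux y dy t))
    rw [norm_flux] at e1
    have e2 := mul_le_mul_of_nonneg_left e1 hk.le
    simp only
    nlinarith [sq_nonneg (k * ‖y t‖ - ‖dy t‖)]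
  rw [integral_neg, integral_const_mul, he, integral_add (h1.const_mul _) h2, integral_const_mul,
    ← tailMass, h.integral_norm_deriv_sq] at hle
  linarith

lemma mul_tailMass_le_flux_im (h : IsRecessive l B y dy) (a : ℝ) :
    a * tailMass y a ≤ (flux y dy a).im := by
  rw [← h.integral_mul_norm_sq, tailMass, ← integral_const_mul]
  refine setIntegral_mono_on ((h.integrableOn_norm_sq a).const_mul a)
    (h.integrableOn_mul_norm_sq a) measurableSet_Ioi fun t ht => ?_
  exact mul_le_mul_of_nonneg_right (le_of_lt ht) (by positivity)

/-- Where the imaginary part of the flux outweighs the tail mass, the flux controls the tail mass,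
the logarithmic derivative is large, and the flux lies in a cone slightly larger than a quadrant. -/
lemma estimates_of_tailMass_le (h : IsRecessive l B y dy) {L k a : ℝ} (hlL : l ≤ L) (hL : 0 ≤ L)
    (hk : 0 < k) (ha : (2 * L + k ^ 2) * tailMass y a ≤ |(flux y dy a).im|) :
    k * ‖y a‖ ≤ 2 * ‖dy a‖ ∧ k ^ 2 * tailMass y a ≤ 2 * (‖dy a‖ * ‖y a‖) ∧
      -|(flux y dy a).im| / 2 ≤ -(flux y dy a).re := by
  have hX := tailMass_nonneg y a
  have hY : 0 ≤ l * tailMass y a - (flux y dy a).re := by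
    rw [← h.integral_norm_deriv_sq]
    exact integral_nonneg fun _ => by positivity
  have hlX : l * tailMass y a ≤ L * tailMass y a := mul_le_mul_of_nonneg_right hlL hX
  have hLX : 0 ≤ L * tailMass y a := mul_nonneg hL hX
  have hkX : 0 ≤ k ^ 2 * tailMass y a := by positivity
  have h1 := (neg_le_abs _).trans (Complex.abs_re_le_norm (flux y dy a))
  have h2 := Complex.abs_im_le_norm (flux y dy a)
  have h3 := h.norm_sq_le hk a
  rw [norm_flux] at h1 h2
  refine ⟨?_, by linarith, by linarith⟩
  rcases (norm_nonneg (y a)).eq_or_lt with h0 | h0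
  · rw [← h0, mul_zero]
    positivity
  · refine le_of_mul_le_mul_right ?_ h0
    nlinarith

end IsRecessive

/-! ### Growth of the dominant solution -/

/-- On the cone `0 ≤ Im`, `-Im / 2 ≤ -Re` the linear functional `Im - Re` dominates the norm. -/
lemma norm_le_of_mem_cone {z : ℂ} (h0 : 0 ≤ z.im) (h1 : -z.im / 2 ≤ -z.re) :
    ‖z‖ ≤ 3 * (z.im - z.re) := by
  have := Complex.norm_le_abs_re_add_abs_im z
  rw [abs_of_nonneg h0] at this
  rcases abs_cases z.re with h | h <;> linarith

/-- If the fluxes `d₁ ȳ₁` and `\bar{d₂} y₂` lie in a common cone of opening less than `π`, the two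
terms of the Wronskian `d₁ ȳ₂ + \bar{d₂} y₁` cannot cancel. -/
lemma norm_add_norm_le_of_flux {y₁ y₂ d₁ d₂ : ℂ}
    (h1 : 0 ≤ (d₁ * starRingEnd ℂ y₁).im)
    (h1' : -(d₁ * starRingEnd ℂ y₁).im / 2 ≤ -(d₁ * starRingEnd ℂ y₁).re)
    (h2 : (d₂ * starRingEnd ℂ y₂).im ≤ 0)
    (h2' : (d₂ * starRingEnd ℂ y₂).im / 2 ≤ -(d₂ * starRingEnd ℂ y₂).re) :
    ‖d₁‖ * ‖y₂‖ + ‖d₂‖ * ‖y₁‖ ≤ 6 * ‖d₁ * starRingEnd ℂ y₂ + starRingEnd ℂ d₂ * y₁‖ := by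
  by_cases e1 : y₁ = 0
  · have : 0 ≤ ‖d₁‖ * ‖y₂‖ := by positivity
    simp only [e1, norm_zero, mul_zero, add_zero, norm_mul, Complex.norm_conj]
    linarith
  by_cases e2 : y₂ = 0
  · have : 0 ≤ ‖d₂‖ * ‖y₁‖ := by positivity
    simp only [e2, norm_zero, mul_zero, zero_add, norm_mul, Complex.norm_conj, map_zero]
    linarith
  set W := d₁ * starRingEnd ℂ y₂ + starRingEnd ℂ d₂ * y₁ with hW
  have n1 : 0 < ‖y₁‖ := norm_pos_iff.mpr e1
  have n2 : 0 < ‖y₂‖ := norm_pos_iff.mpr e2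
  have c1 := norm_le_of_mem_cone h1 h1'
  have c2 := norm_le_of_mem_cone (z := starRingEnd ℂ (d₂ * starRingEnd ℂ y₂))
    (by rw [Complex.conj_im]; linarith) (by rw [Complex.conj_im, Complex.conj_re]; linarith)
  rw [Complex.norm_conj, Complex.conj_im, Complex.conj_re] at c2
  -- multiplying the Wronskian by `ȳ₁ y₂` exhibits it as a combination of the fluxes
  have hZ : W * (starRingEnd ℂ y₁ * y₂) = (d₁ * starRingEnd ℂ y₁) * (‖y₂‖ ^ 2 : ℝ) +
      starRingEnd ℂ (d₂ * starRingEnd ℂ y₂) * (‖y₁‖ ^ 2 : ℝ) := by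
    have m1 := Complex.mul_conj' y₁
    have m2 := Complex.mul_conj' y₂
    rw [hW, map_mul, Complex.conj_conj]
    push_cast
    rw [← m1, ← m2]
    ring
  have hre := congrArg Complex.re hZ
  have him := congrArg Complex.im hZ
  rw [Complex.add_re, Complex.re_mul_ofReal, Complex.re_mul_ofReal, Complex.conj_re] at hre
  rw [Complex.add_im, Complex.im_mul_ofReal, Complex.im_mul_ofReal, Complex.conj_im] at him
  have b1 := (neg_le_abs _).trans (Complex.abs_re_le_norm (W * (starRingEnd ℂ y₁ * y₂)))
  have b2 := (le_abs_self _).trans (Complex.abs_im_le_norm (W * (starRingEnd ℂ y₁ * y₂)))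
  rw [norm_mul, norm_mul, Complex.norm_conj] at b1 b2
  rw [norm_mul, Complex.norm_conj] at c1 c2
  have s1 := mul_le_mul_of_nonneg_right c1 (sq_nonneg ‖y₂‖)
  have s2 := mul_le_mul_of_nonneg_right c2 (sq_nonneg ‖y₁‖)
  refine le_of_mul_le_mul_right ?_ (mul_pos n1 n2)
  nlinarith

namespace IsRecessive

variable {l B : ℝ} {y dy : ℝ → ℂ}

/-- The mass of the solution in the direction in which it is dominant tends to infinity, uniformly:
as long as `∫ |y| ^ 2` over `(-t, ∞)` stays below `R`, the integral of `|y'| ^ 2` grows at least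
linearly in `t`, hence `|y| ^ 2` quadratically and its integral cubically. -/
lemma lt_tailMass_neg (h : IsRecessive l B y dy) {L R c T : ℝ} (hlL : l ≤ L)
    (hL : 0 ≤ L) (hR : 0 ≤ R) (hc : ∀ t, t ≤ 0 → c ≤ ‖y t‖ ^ 2 + ‖dy t‖ ^ 2) (hT : R + 1 ≤ T)
    (hT' : 3 * ((1 + L) * R + 1) ≤ c * T) : R < tailMass y (-T) := by
  by_contra! hcon
  have hT0 : 0 ≤ T := by linarith
  have hX : ∀ a, -T ≤ a → tailMass y a ≤ R := fun a ha => (h.tailMass_le_of_le ha).trans hcon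
  have hY : ∀ a, a ≤ 0 → c * (-a) ≤
      tailMass y a + (l * tailMass y a - (flux y dy a).re) := by
    intro a ha
    have := le_of_hasDerivAt_nonneg
      (f := fun a => -(tailMass y a + (l * tailMass y a - (flux y dy a).re)) - c * a)
      (fun x => (((h.hasDerivAt_tailMass x).fun_add (((h.hasDerivAt_tailMass x).const_mul l).fun_sub
        (h.hasDerivAt_flux_re x))).fun_neg).fun_sub ((hasDerivAt_id x).const_mul c)) ha
      (fun x hx => by have := hc x hx.2; linarith)
    have h0 : 0 ≤ tailMass y 0 + (l * tailMass y 0 - (flux y dy 0).re) := by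
      rw [← h.integral_norm_deriv_sq]
      exact add_nonneg (tailMass_nonneg _ _) (integral_nonneg fun _ => by positivity)
    linarith
  have hre : ∀ a ∈ Set.Icc (-T) 0, (flux y dy a).re ≤ (1 + L) * R + c * a := by
    intro a ha
    have h1 := hY a ha.2
    have h2 := hX a ha.1
    have h3 : l * tailMass y a ≤ L * R :=
      (mul_le_mul_of_nonneg_right hlL (tailMass_nonneg _ _)).trans
        (mul_le_mul_of_nonneg_left h2 hL)
    linarith
  have hF : ∀ a ∈ Set.Icc (-T) 0, c * a ^ 2 + 2 * ((1 + L) * R) * a ≤ ‖y a‖ ^ 2 := by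
    intro a ha
    have := le_of_hasDerivAt_nonneg
      (f := fun a => (c * a ^ 2 + 2 * ((1 + L) * R) * a) - ‖y a‖ ^ 2)
      (fun x => ((((hasDerivAt_id x).pow 2).const_mul c).fun_add
        ((hasDerivAt_id x).const_mul (2 * ((1 + L) * R)))).fun_sub (h.hasDerivAt_norm_sq x)) ha.2
      (fun x hx => by
        have := hre x ⟨ha.1.trans hx.1, hx.2⟩
        simp only [id]
        push_cast
        linarith)
    have h0 : 0 ≤ ‖y 0‖ ^ 2 := by positivity
    linarith
  have hfin := le_of_hasDerivAt_nonneg (a := -T) (b := 0)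
    (f := fun a => -(c * a ^ 3 / 3 + (1 + L) * R * a ^ 2) - tailMass y a)
    (fun x => (((((hasDerivAt_id x).pow 3).const_mul c).div_const 3).fun_add
        (((hasDerivAt_id x).pow 2).const_mul ((1 + L) * R))).fun_neg.fun_sub
        (h.hasDerivAt_tailMass x)) (by linarith)
    (fun x hx => by
      have := hF x hx
      simp only [id]
      push_cast
      linarith)
  have h0 := tailMass_nonneg y 0
  nlinarith [mul_le_mul_of_nonneg_left hT' (sq_nonneg T), sq_nonneg T]

/-- The Wronskian bounds the dominant solution from below. The summand `1` in the denominator only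
keeps it positive. -/
lemma le_norm_sq_add_norm_sq (h : IsRecessive l B y dy) {ω : ℝ}
    (hω : ∀ t, ‖dy t * starRingEnd ℂ (y (-t)) + starRingEnd ℂ (dy (-t)) * y t‖ = ω) (t : ℝ)
    (ht : t ≤ 0) : ω ^ 2 / (2 * B ^ 2 + 1) ≤ ‖y t‖ ^ 2 + ‖dy t‖ ^ 2 := by
  have h1 := norm_add_le (dy t * starRingEnd ℂ (y (-t))) (starRingEnd ℂ (dy (-t)) * y t)
  rw [hω, norm_mul, norm_mul, Complex.norm_conj, Complex.norm_conj] at h1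
  have h2 := mul_le_mul_of_nonneg_left (h.norm_le (-t) (by linarith)) (norm_nonneg (dy t))
  have h3 := mul_le_mul_of_nonneg_right (h.norm_deriv_le (-t) (by linarith)) (norm_nonneg (y t))
  have hω0 : 0 ≤ ω := (hω 0) ▸ norm_nonneg _
  have h4 : ω ≤ B * (‖dy t‖ + ‖y t‖) := by linarith
  have h5 := pow_le_pow_left₀ hω0 h4 2
  rw [div_le_iff₀ (by positivity)]
  nlinarith [mul_nonneg (sq_nonneg B) (sq_nonneg (‖dy t‖ - ‖y t‖)), sq_nonneg ‖y t‖,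
    sq_nonneg ‖dy t‖]

/-- In the dominant direction the flux controls an arbitrary multiple of the mass, up to a constant:
the derivative `-(t + S) |y| ^ 2` of `Im Φ + S X`, with flux `Φ` and tail mass `X`, is nonnegative for
`t ≤ -S`. -/
lemma mul_tailMass_le_neg_flux_im (h : IsRecessive l B y dy) {S B' a : ℝ} (hS : 0 ≤ S)
    (hB : ∀ t, -S ≤ t → ‖y t‖ ≤ B') (hB' : ∀ t, -S ≤ t → ‖dy t‖ ≤ B') (ha : a ≤ -S) :
    S * tailMass y a - (B' ^ 2 + S * ((S + 2) * B' ^ 2)) ≤ -(flux y dy a).im := by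
  have hf : ∀ t, -S ≤ t → (flux y dy t).im ≤ B' ^ 2 := by
    intro t ht
    refine ((le_abs_self _).trans (Complex.abs_im_le_norm _)).trans ?_
    rw [norm_flux, sq]
    exact mul_le_mul (hB' t ht) (hB t ht) (norm_nonneg _) ((norm_nonneg _).trans (hB' t ht))
  have h1 : tailMass y 1 ≤ B' ^ 2 := by
    have := h.mul_tailMass_le_flux_im 1
    rw [one_mul] at this
    exact this.trans (hf 1 (by linarith))
  have h2 : tailMass y (-S) ≤ (S + 2) * B' ^ 2 := by
    have := le_of_hasDerivAt_nonneg (f := fun a => tailMass y a + B' ^ 2 * a)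
      (fun x => (h.hasDerivAt_tailMass x).fun_add ((hasDerivAt_id x).const_mul (B' ^ 2)))
      (show -S ≤ 1 by linarith)
      (fun x hx => by
        have := pow_le_pow_left₀ (norm_nonneg _) (hB x hx.1) 2
        linarith)
    linarith
  have h3 := le_of_hasDerivAt_nonneg (f := fun a => (flux y dy a).im + S * tailMass y a)
      (fun x => (h.hasDerivAt_flux_im x).fun_add ((h.hasDerivAt_tailMass x).const_mul S)) ha
      (fun x hx => by nlinarith [hx.2, sq_nonneg ‖y x‖])
  have h4 := hf (-S) le_rfl
  have h5 := mul_le_mul_of_nonneg_left h2 hS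
  linarith

/-- The bounds that drive the convergence, for every parameter `k`, as soon as `η` is large in terms
of `k`, the Wronskian and the uniform bounds of the solution. -/
lemma estimates_of_large {L k ω : ℝ} (hL : 0 ≤ L) (hk : 0 < k) (hω0 : 0 < ω) (B B' : ℝ) :
    ∃ T : ℝ, ∀ η, T ≤ η → ∀ (l : ℝ) (y dy : ℝ → ℂ), l ≤ L → IsRecessive l B y dy →
      (∀ t, -(2 * L + k ^ 2 + 1) ≤ t → ‖y t‖ ≤ B') →
      (∀ t, -(2 * L + k ^ 2 + 1) ≤ t → ‖dy t‖ ≤ B') →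
      (∀ t, ‖dy t * starRingEnd ℂ (y (-t)) + starRingEnd ℂ (dy (-t)) * y t‖ = ω) →
      k * ω / 4 ≤ ‖dy η‖ * ‖dy (-η)‖ ∧
      k ^ 2 * tailMass y η * ‖dy (-η)‖ ≤ 12 * ω * ‖dy η‖ ∧
      k ^ 2 * tailMass y (-η) * ‖dy η‖ ≤ 12 * ω * ‖dy (-η)‖ ∧
      k ^ 4 * (tailMass y η * tailMass y (-η)) ≤ 144 * ω ^ 2 := by
  set S := 2 * L + k ^ 2 with hS
  set R := B' ^ 2 + (S + 1) * ((S + 1 + 2) * B' ^ 2) with hR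
  set c := ω ^ 2 / (2 * B ^ 2 + 1) with hc
  have hS0 : 0 < S := by positivity
  have hR0 : 0 ≤ R := by positivity
  have hc0 : 0 < c := by positivity
  -- `2 L + k ^ 2 + 1` in place of `2 L + k ^ 2` leaves one multiple of the mass to absorb `R`
  refine ⟨max (S + 1) (max (R + 1) (3 * ((1 + L) * R + 1) / c)),
    fun η hη l y dy hlL h hB hB' hω => ?_⟩
  have hη1 : S + 1 ≤ η := (le_max_left _ _).trans hη
  have hη2 : R + 1 ≤ η := (le_max_left _ _).trans ((le_max_right _ _).trans hη)
  have hη3 : 3 * ((1 + L) * R + 1) ≤ c * η := by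
    rw [mul_comm c, ← div_le_iff₀ hc0]
    exact (le_max_right _ _).trans ((le_max_right _ _).trans hη)
  have hgrow := h.lt_tailMass_neg hlL hL hR0 (h.le_norm_sq_add_norm_sq hω) hη2 hη3
  have hneg := h.mul_tailMass_le_neg_flux_im (S := S + 1) (a := -η) (by linarith) hB hB'
    (by linarith)
  rw [← hR] at hneg
  have hX2 : S * tailMass y (-η) ≤ -(flux y dy (-η)).im := by linarith
  have hX1 : S * tailMass y η ≤ (flux y dy η).im :=
    (mul_le_mul_of_nonneg_right (by linarith) (tailMass_nonneg _ _)).trans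
      (h.mul_tailMass_le_flux_im η)
  have hv1 : 0 ≤ (flux y dy η).im := (mul_nonneg hS0.le (tailMass_nonneg _ _)).trans hX1
  have hv2 : (flux y dy (-η)).im ≤ 0 := by
    have := (mul_nonneg hS0.le (tailMass_nonneg y (-η))).trans hX2
    linarith
  obtain ⟨p1, p2, p3⟩ := h.estimates_of_tailMass_le hlL hL hk (a := η)
    (by rw [abs_of_nonneg hv1]; exact hX1)
  obtain ⟨q1, q2, q3⟩ := h.estimates_of_tailMass_le hlL hL hk (a := -η)
    (by rw [abs_of_nonpos hv2]; exact hX2)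
  rw [abs_of_nonneg hv1] at p3
  rw [abs_of_nonpos hv2, neg_neg] at q3
  have hsum := norm_add_norm_le_of_flux (y₁ := y η) (d₁ := dy η) (y₂ := y (-η)) (d₂ := dy (-η))
    hv1 p3 hv2 q3
  rw [hω] at hsum
  have hlow := norm_add_le (dy η * starRingEnd ℂ (y (-η))) (starRingEnd ℂ (dy (-η)) * y η)
  rw [hω, norm_mul, norm_mul, Complex.norm_conj, Complex.norm_conj] at hlow
  have hP : 0 ≤ ‖dy η‖ * ‖y (-η)‖ := by positivity
  have hQ : 0 ≤ ‖dy (-η)‖ * ‖y η‖ := by positivity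
  have hX1' := tailMass_nonneg y η
  have hX2' := tailMass_nonneg y (-η)
  refine ⟨?_, ?_, ?_, ?_⟩
  · have r1 := mul_le_mul_of_nonneg_right p1 (norm_nonneg (dy (-η)))
    have r2 := mul_le_mul_of_nonneg_right q1 (norm_nonneg (dy η))
    have r3 := mul_le_mul_of_nonneg_left hlow hk.le
    linarith
  · have r1 := mul_le_mul_of_nonneg_right p2 (norm_nonneg (dy (-η)))
    have r2 : (‖dy (-η)‖ * ‖y η‖) * ‖dy η‖ ≤ 6 * ω * ‖dy η‖ :=
      mul_le_mul_of_nonneg_right (by linarith) (norm_nonneg _)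
    linarith
  · have r1 := mul_le_mul_of_nonneg_right q2 (norm_nonneg (dy η))
    have r2 : (‖dy η‖ * ‖y (-η)‖) * ‖dy (-η)‖ ≤ 6 * ω * ‖dy (-η)‖ :=
      mul_le_mul_of_nonneg_right (by linarith) (norm_nonneg _)
    linarith
  · calc k ^ 4 * (tailMass y η * tailMass y (-η))
        = (k ^ 2 * tailMass y η) * (k ^ 2 * tailMass y (-η)) := by ring
      _ ≤ (2 * (‖dy η‖ * ‖y η‖)) * (2 * (‖dy (-η)‖ * ‖y (-η)‖)) :=
        mul_le_mul p2 q2 (by positivity) (by positivity)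
      _ = 4 * ((‖dy η‖ * ‖y (-η)‖) * (‖dy (-η)‖ * ‖y η‖)) := by ring
      _ ≤ 4 * ((6 * ω) * (6 * ω)) := by
        have := mul_le_mul (show ‖dy η‖ * ‖y (-η)‖ ≤ 6 * ω by linarith)
          (show ‖dy (-η)‖ * ‖y η‖ ≤ 6 * ω by linarith) hQ (by positivity)
        linarith
      _ = 144 * ω ^ 2 := by ring

end IsRecessive

/-! ### The Hilbert–Schmidt norm -/

lemma airyLine_isRecessive {l B : ℝ}
    (hB : ∀ t, 0 ≤ t → ‖airyLine l t‖ ≤ B ∧ ‖airyLineDeriv l t‖ ≤ B) :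
    IsRecessive l B (airyLine l) (airyLineDeriv l) where
  hasDerivAt := hasDerivAt_airyLine l
  hasDerivAt_deriv := hasDerivAt_airyLineDeriv l
  norm_le t ht := (hB t ht).1
  norm_deriv_le t ht := (hB t ht).2

lemma airyAi_rotNeg_airyArg (l η x : ℝ) :
    airyAi (rotNeg * airyArg (l + Complex.I * η) x) = airyLine l (x + η) := by
  unfold airyLine airyArg
  congr 2
  push_cast
  ring

lemma airyAi_rotPos_airyArg (l η x : ℝ) : airyAi (rotPos * airyArg (l + Complex.I * η) x) =
    starRingEnd ℂ (airyLine l (-(x + η))) := by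
  rw [conj_airyLine_neg]
  unfold airyArg
  congr 2
  push_cast
  ring

lemma norm_airyAiDeriv_rotNeg (l η : ℝ) :
    ‖airyAiDeriv (rotNeg * (l + Complex.I * η))‖ = ‖airyLineDeriv l η‖ := by
  rw [airyLineDeriv, norm_mul, norm_mul, Complex.norm_I, norm_rotNeg, one_mul, one_mul]

lemma norm_airyAiDeriv_rotPos (l η : ℝ) :
    ‖airyAiDeriv (rotPos * (l + Complex.I * η))‖ = ‖airyLineDeriv l (-η)‖ := by
  rw [← Complex.norm_conj (airyLineDeriv l (-η)), conj_airyLineDeriv_neg, norm_neg, norm_mul,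
    norm_mul, Complex.norm_I, norm_rotPos, one_mul, one_mul]

/-- The density of the mass of the factor of the kernel supported on the right half line. -/
noncomputable def rightDensity (l η : ℝ) : ℝ → ℝ :=
  (Set.Ioi 0).indicator fun x => ‖airyLine l (x + η)‖ ^ 2

/-- The density of the mass of the factor of the kernel supported on the left half line. -/
noncomputable def leftDensity (l η : ℝ) : ℝ → ℝ :=
  (Set.Iic 0).indicator fun x => ‖airyLine l (-(x + η))‖ ^ 2

lemma rightDensity_nonneg (l η x : ℝ) : 0 ≤ rightDensity l η x :=
  Set.indicator_nonneg (fun _ _ => by positivity) x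

lemma leftDensity_nonneg (l η x : ℝ) : 0 ≤ leftDensity l η x :=
  Set.indicator_nonneg (fun _ _ => by positivity) x

lemma integral_rightDensity (l η : ℝ) :
    ∫ x, rightDensity l η x = tailMass (airyLine l) η := by
  have := (measurePreserving_add_right volume η).setIntegral_preimage_emb
    (MeasurableEquiv.addRight η).measurableEmbedding (fun x => ‖airyLine l x‖ ^ 2) (Set.Ioi η)
  rw [rightDensity, integral_indicator measurableSet_Ioi, tailMass, ← this]
  congr 2
  simp

lemma integrable_rightDensity {l B : ℝ} (h : IsRecessive l B (airyLine l) (airyLineDeriv l))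
    (η : ℝ) : Integrable (rightDensity l η) := by
  rw [rightDensity, integrable_indicator_iff measurableSet_Ioi]
  have := ((measurePreserving_add_right volume η).integrableOn_comp_preimage
    (MeasurableEquiv.addRight η).measurableEmbedding).mpr (h.integrableOn_norm_sq η)
  rw [Set.preimage_add_const_Ioi, sub_self] at this
  exact this

lemma leftDensity_preimage (l η : ℝ) :
    leftDensity l η =ᵐ[volume] fun x => rightDensity l (-η) (-x) := by
  filter_upwards [compl_mem_ae_iff.mpr (measure_singleton (0 : ℝ))] with x hx
  have hx0 : x ≠ 0 := hx
  unfold leftDensity rightDensity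
  rcases lt_or_gt_of_ne hx0 with h | h
  · rw [Set.indicator_of_mem (show x ∈ Set.Iic 0 from h.le),
      Set.indicator_of_mem (show -x ∈ Set.Ioi 0 from neg_pos.mpr h)]
    congr 3
    ring
  · rw [Set.indicator_of_notMem (by simpa using h), Set.indicator_of_notMem (by simpa using h.le)]

lemma integral_leftDensity (l η : ℝ) :
    ∫ x, leftDensity l η x = tailMass (airyLine l) (-η) := by
  rw [integral_congr_ae (leftDensity_preimage l η), integral_neg_eq_self (rightDensity l (-η)),
    integral_rightDensity]

lemma integrable_leftDensity {l B : ℝ} (h : IsRecessive l B (airyLine l) (airyLineDeriv l))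
    (η : ℝ) : Integrable (leftDensity l η) :=
  (integrable_rightDensity h (-η)).comp_neg.congr (leftDensity_preimage l η).symm

/-- On each quadrant the kernel is a constant times a product of functions of `x` and of `y`. -/
lemma norm_transmissionG₁_sq_le {κ l η C₁ C₂ C₃ : ℝ}
    (h1 : ‖4 * Real.pi ^ 2 * (rotPos ^ 2 * airyAiDeriv (rotPos * (l + Complex.I * η)) ^ 2 /
      (airyF (l + Complex.I * η) + κ))‖ ≤ C₁)
    (h2 : ‖2 * Real.pi * (airyF (l + Complex.I * η) / (airyF (l + Complex.I * η) + κ))‖ ≤ C₂)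
    (h3 : ‖4 * Real.pi ^ 2 * (rotNeg ^ 2 * airyAiDeriv (rotNeg * (l + Complex.I * η)) ^ 2 /
      (airyF (l + Complex.I * η) + κ))‖ ≤ C₃) (x y : ℝ) :
    ‖transmissionG₁ κ (l + Complex.I * η) x y‖ ^ 2 ≤
      C₁ ^ 2 * (rightDensity l η x * rightDensity l η y) +
      C₂ ^ 2 * (leftDensity l η x * rightDensity l η y) +
      C₂ ^ 2 * (rightDensity l η x * leftDensity l η y) +
      C₃ ^ 2 * (leftDensity l η x * leftDensity l η y) := by
  unfold transmissionG₁ rightDensity leftDensity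
  split_ifs with hy hx hx
  all_goals
    simp only [airyAi_rotNeg_airyArg, airyAi_rotPos_airyArg, norm_neg, norm_mul _ (airyLine _ _),
      norm_mul _ (starRingEnd ℂ _), Complex.norm_conj, mul_pow, Set.indicator, Set.mem_Ioi,
      Set.mem_Iic, hx, hy, not_le.mpr, not_lt.mp, if_true, if_false, mul_zero, zero_mul, add_zero,
      zero_add, not_false_eq_true]
    rw [mul_assoc]
    gcongr

/-- The estimates of `IsRecessive.estimates_of_large` bound the norm; they are invariant under
`η ↦ -η`, so that both directions of the limit are covered. -/
lemma normG₁_le {κ l η k ω B : ℝ} (hκ : 0 ≤ κ) (hk : 0 < k) (hω : 0 < ω)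
    (hkκ : 4 * κ ≤ k * ω) (h : IsRecessive l B (airyLine l) (airyLineDeriv l))
    (h1 : k * ω / 4 ≤ ‖airyLineDeriv l η‖ * ‖airyLineDeriv l (-η)‖)
    (h2 : k ^ 2 * tailMass (airyLine l) η * ‖airyLineDeriv l (-η)‖ ≤
      12 * ω * ‖airyLineDeriv l η‖)
    (h3 : k ^ 2 * tailMass (airyLine l) (-η) * ‖airyLineDeriv l η‖ ≤
      12 * ω * ‖airyLineDeriv l (-η)‖)
    (h4 : k ^ 4 * (tailMass (airyLine l) η * tailMass (airyLine l) (-η)) ≤ 144 * ω ^ 2) :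
    normG₁ κ (l + Complex.I * η) ≤ ENNReal.ofReal (96 * Real.pi * ω / k ^ 2) := by
  set d₁ := ‖airyLineDeriv l η‖ with hd₁
  set d₂ := ‖airyLineDeriv l (-η)‖ with hd₂
  set X₁ := tailMass (airyLine l) η with hX₁
  set X₂ := tailMass (airyLine l) (-η) with hX₂
  have hX₁0 : 0 ≤ X₁ := tailMass_nonneg _ _
  have hX₂0 : 0 ≤ X₂ := tailMass_nonneg _ _
  have hπ := Real.pi_gt_three
  have hdd : 0 < d₁ * d₂ := lt_of_lt_of_le (by positivity) h1
  have hd₁0 : 0 < d₁ := pos_of_mul_pos_left hdd (norm_nonneg _)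
  have hd₂0 : 0 < d₂ := pos_of_mul_pos_right hdd (norm_nonneg _)
  have hf : ‖airyF (l + Complex.I * η)‖ = 2 * Real.pi * (d₁ * d₂) := by
    rw [airyF, norm_mul, norm_mul, norm_airyAiDeriv_rotNeg, norm_airyAiDeriv_rotPos, norm_mul,
      Complex.norm_ofNat, Complex.norm_real, Real.norm_of_nonneg Real.pi_pos.le, mul_assoc]
  have hfκ : Real.pi * (d₁ * d₂) ≤ ‖airyF (l + Complex.I * η) + κ‖ := by
    have e1 := norm_sub_le_norm_add (airyF (l + Complex.I * η)) (κ : ℂ)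
    rw [hf, Complex.norm_real, Real.norm_of_nonneg hκ] at e1
    nlinarith
  have hD : 0 < Real.pi * (d₁ * d₂) := by positivity
  have c1 : ‖4 * Real.pi ^ 2 * (rotPos ^ 2 * airyAiDeriv (rotPos * (l + Complex.I * η)) ^ 2 /
      (airyF (l + Complex.I * η) + κ))‖ ≤ 4 * Real.pi * d₂ / d₁ := by
    rw [norm_mul, norm_div, norm_mul (rotPos ^ 2), norm_pow rotPos, norm_rotPos, norm_pow,
      norm_airyAiDeriv_rotPos, norm_mul, norm_pow, Complex.norm_ofNat, Complex.norm_real,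
      Real.norm_of_nonneg Real.pi_pos.le, one_pow, one_mul, ← hd₂]
    calc 4 * Real.pi ^ 2 * (d₂ ^ 2 / ‖airyF (l + Complex.I * η) + κ‖)
        ≤ 4 * Real.pi ^ 2 * (d₂ ^ 2 / (Real.pi * (d₁ * d₂))) := by gcongr
      _ = 4 * Real.pi * d₂ / d₁ := by field_simp
  have c2 : ‖2 * Real.pi * (airyF (l + Complex.I * η) / (airyF (l + Complex.I * η) + κ))‖ ≤
      4 * Real.pi := by
    rw [norm_mul, norm_div, hf, norm_mul, Complex.norm_ofNat, Complex.norm_real,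
      Real.norm_of_nonneg Real.pi_pos.le]
    calc 2 * Real.pi * (2 * Real.pi * (d₁ * d₂) / ‖airyF (l + Complex.I * η) + κ‖)
        ≤ 2 * Real.pi * (2 * Real.pi * (d₁ * d₂) / (Real.pi * (d₁ * d₂))) := by gcongr
      _ = 4 * Real.pi := by field_simp; ring
  have c3 : ‖4 * Real.pi ^ 2 * (rotNeg ^ 2 * airyAiDeriv (rotNeg * (l + Complex.I * η)) ^ 2 /
      (airyF (l + Complex.I * η) + κ))‖ ≤ 4 * Real.pi * d₁ / d₂ := by
    rw [norm_mul, norm_div, norm_mul (rotNeg ^ 2), norm_pow rotNeg, norm_rotNeg, norm_pow,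
      norm_airyAiDeriv_rotNeg, norm_mul, norm_pow, Complex.norm_ofNat, Complex.norm_real,
      Real.norm_of_nonneg Real.pi_pos.le, one_pow, one_mul, ← hd₁]
    calc 4 * Real.pi ^ 2 * (d₁ ^ 2 / ‖airyF (l + Complex.I * η) + κ‖)
        ≤ 4 * Real.pi ^ 2 * (d₁ ^ 2 / (Real.pi * (d₁ * d₂))) := by gcongr
      _ = 4 * Real.pi * d₁ / d₂ := by field_simp
  have iR := integrable_rightDensity h η
  have iL := integrable_leftDensity h η
  have j1 := (iR.mul_prod iR).const_mul ((4 * Real.pi * d₂ / d₁) ^ 2)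
  have j2 := (iL.mul_prod iR).const_mul ((4 * Real.pi) ^ 2)
  have j3 := (iR.mul_prod iL).const_mul ((4 * Real.pi) ^ 2)
  have j4 := (iL.mul_prod iL).const_mul ((4 * Real.pi * d₁ / d₂) ^ 2)
  set G : ℝ × ℝ → ℝ := fun p =>
    (4 * Real.pi * d₂ / d₁) ^ 2 * (rightDensity l η p.1 * rightDensity l η p.2) +
    (4 * Real.pi) ^ 2 * (leftDensity l η p.1 * rightDensity l η p.2) +
    (4 * Real.pi) ^ 2 * (rightDensity l η p.1 * leftDensity l η p.2) +
    (4 * Real.pi * d₁ / d₂) ^ 2 * (leftDensity l η p.1 * leftDensity l η p.2) with hG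
  have hGi : Integrable G volume := ((j1.add j2).add j3).add j4
  have hGv : ∫ p, G p = (4 * Real.pi * d₂ / d₁) ^ 2 * (X₁ * X₁) + (4 * Real.pi) ^ 2 * (X₂ * X₁) +
      (4 * Real.pi) ^ 2 * (X₁ * X₂) + (4 * Real.pi * d₁ / d₂) ^ 2 * (X₂ * X₂) := by
    refine (integral_add' ((j1.add j2).add j3) j4).trans ?_
    rw [integral_add' (j1.add j2) j3, integral_add' j1 j2, integral_const_mul, integral_const_mul,
      integral_const_mul, integral_const_mul, integral_prod_mul, integral_prod_mul,
      integral_prod_mul, integral_prod_mul, integral_rightDensity, integral_leftDensity]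
  have hint : ∫⁻ p : ℝ × ℝ, ‖transmissionG₁ κ (l + Complex.I * η) p.1 p.2‖ₑ ^ (2 : ℝ) ≤
      ENNReal.ofReal ((96 * Real.pi * ω / k ^ 2) ^ (2 : ℝ)) := by
    have hpt : ∀ p : ℝ × ℝ, ‖transmissionG₁ κ (l + Complex.I * η) p.1 p.2‖ₑ ^ (2 : ℝ) ≤
        ENNReal.ofReal (G p) := by
      intro p
      rw [← ofReal_norm, ENNReal.ofReal_rpow_of_nonneg (norm_nonneg _) zero_le_two, Real.rpow_two]
      exact ENNReal.ofReal_le_ofReal (norm_transmissionG₁_sq_le c1 c2 c3 p.1 p.2)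
    refine (lintegral_mono hpt).trans ?_
    rw [← ofReal_integral_eq_lintegral_ofReal hGi (Eventually.of_forall fun p => ?_)]
    · refine ENNReal.ofReal_le_ofReal ?_
      rw [Real.rpow_two, hGv]
      have b1 : 4 * Real.pi * d₂ / d₁ * X₁ ≤ 48 * Real.pi * ω / k ^ 2 := by
        rw [div_mul_eq_mul_div, div_le_div_iff₀ hd₁0 (by positivity)]
        nlinarith [mul_le_mul_of_nonneg_left h2 Real.pi_pos.le]
      have b3 : 4 * Real.pi * d₁ / d₂ * X₂ ≤ 48 * Real.pi * ω / k ^ 2 := by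
        rw [div_mul_eq_mul_div, div_le_div_iff₀ hd₂0 (by positivity)]
        nlinarith [mul_le_mul_of_nonneg_left h3 Real.pi_pos.le]
      have b2 : (4 * Real.pi) ^ 2 * (X₁ * X₂) ≤ (48 * Real.pi * ω / k ^ 2) ^ 2 := by
        rw [div_pow, le_div_iff₀ (by positivity)]
        nlinarith [mul_le_mul_of_nonneg_left h4 (sq_nonneg Real.pi)]
      have s1 := pow_le_pow_left₀ (by positivity) b1 2
      have s3 := pow_le_pow_left₀ (by positivity) b3 2
      have e : (96 * Real.pi * ω / k ^ 2) ^ 2 = 4 * (48 * Real.pi * ω / k ^ 2) ^ 2 := by ring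
      rw [mul_pow] at s1 s3
      rw [e, mul_comm X₂ X₁]
      linarith
    · have := rightDensity_nonneg l η p.1
      have := rightDensity_nonneg l η p.2
      have := leftDensity_nonneg l η p.1
      have := leftDensity_nonneg l η p.2
      simp only [Pi.zero_apply, hG]
      positivity
  rw [normG₁, eLpNorm_eq_lintegral_rpow_enorm_toReal two_ne_zero ENNReal.ofNat_ne_top,
    ENNReal.toReal_ofNat]
  refine (ENNReal.rpow_le_rpow hint (by norm_num)).trans_eq ?_
  rw [← ENNReal.ofReal_rpow_of_nonneg (by positivity) zero_le_two, ← ENNReal.rpow_mul]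
  norm_num

lemma exists_forall_normG₁_le {κ : ℝ} (hκ : 0 ≤ κ) {L : ℝ} (hL : 0 ≤ L) {ε : ℝ≥0∞} (hε : 0 < ε) :
    ∃ T : ℝ, ∀ η, T ≤ |η| → ∀ l, 0 ≤ l → l ≤ L → normG₁ κ (l + Complex.I * η) ≤ ε := by
  set ω := ‖airyWronskian 0‖ with hω
  have hω0 : 0 < ω := norm_pos_iff.mpr airyWronskian_zero_ne_zero
  have hlim : Tendsto (fun k : ℝ => ENNReal.ofReal (96 * Real.pi * ω / k ^ 2)) atTop (𝓝 0) := by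
    rw [← ENNReal.ofReal_zero]
    exact (ENNReal.continuous_ofReal.tendsto 0).comp
      ((tendsto_pow_atTop two_ne_zero).const_div_atTop _)
  obtain ⟨k, hkε, hk0, hkκ⟩ := ((hlim.eventually (Iic_mem_nhds hε)).and
    ((eventually_gt_atTop 0).and (eventually_ge_atTop (4 * κ / ω)))).exists
  obtain ⟨B, hB⟩ := exists_bound_airyLine L 0 le_rfl
  obtain ⟨B', hB'⟩ := exists_bound_airyLine L (2 * L + k ^ 2 + 1) (by positivity)
  obtain ⟨T, hT⟩ := IsRecessive.estimates_of_large hL hk0 hω0 B B'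
  refine ⟨T, fun η hη l hl hlL => ?_⟩
  have h : IsRecessive l B (airyLine l) (airyLineDeriv l) :=
    airyLine_isRecessive fun t ht => hB l t hl hlL (by simpa using ht)
  obtain ⟨e1, e2, e3, e4⟩ := hT |η| hη l _ _ hlL h (fun t ht => (hB' l t hl hlL ht).1)
    (fun t ht => (hB' l t hl hlL ht).2) (norm_airyLine_wronskian l)
  refine le_trans ?_ hkε
  have hkκ' : 4 * κ ≤ k * ω := (div_le_iff₀ hω0).mp hkκ
  rcases abs_choice η with hs | hs
  · rw [hs] at e1 e2 e3 e4
    exact normG₁_le hκ hk0 hω0 hkκ' h e1 e2 e3 e4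
  · rw [hs, neg_neg] at e1 e2 e3 e4
    exact normG₁_le hκ hk0 hω0 hkκ' h (by rwa [mul_comm ‖_‖]) e3 e2
      (by rwa [mul_comm (tailMass _ _)])

lemma tendsto_iSup_normG₁ {κ : ℝ} (hκ : 0 ≤ κ) {K : Set ℝ} (hK : BddAbove K)
    (hK0 : K ⊆ Set.Ioi 0) {F : Filter ℝ} (hF : Tendsto (fun η : ℝ => |η|) F atTop) :
    Tendsto (fun η : ℝ => ⨆ l₀ ∈ K, normG₁ κ (l₀ + Complex.I * η)) F (𝓝 0) := by
  obtain ⟨L, hL⟩ := hK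
  rw [ENNReal.tendsto_nhds_zero]
  intro ε hε
  obtain ⟨T, hT⟩ := exists_forall_normG₁_le hκ (abs_nonneg L) hε
  filter_upwards [hF.eventually_ge_atTop T] with η hη
  exact iSup₂_le fun l hl => hT η hη l (le_of_lt (hK0 hl)) ((hL hl).trans (le_abs_self L))

theorem mainTheorem6 (κ : ℝ) (hκ : 0 ≤ κ) :
    (∀ l₀ : ℝ, 0 < l₀ →
      Tendsto (fun η : ℝ => normG₁ κ (l₀ + Complex.I * η)) atTop (𝓝 0) ∧
      Tendsto (fun η : ℝ => normG₁ κ (l₀ + Complex.I * η)) atBot (𝓝 0)) ∧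
    (∀ K : Set ℝ, IsCompact K → K ⊆ Set.Ioi 0 →
      Tendsto (fun η : ℝ => ⨆ l₀ ∈ K, normG₁ κ (l₀ + Complex.I * η)) atTop (𝓝 0) ∧
      Tendsto (fun η : ℝ => ⨆ l₀ ∈ K, normG₁ κ (l₀ + Complex.I * η)) atBot (𝓝 0)) := by
  have hunif : ∀ K : Set ℝ, IsCompact K → K ⊆ Set.Ioi 0 →
      Tendsto (fun η : ℝ => ⨆ l₀ ∈ K, normG₁ κ (l₀ + Complex.I * η)) atTop (𝓝 0) ∧
      Tendsto (fun η : ℝ => ⨆ l₀ ∈ K, normG₁ κ (l₀ + Complex.I * η)) atBot (𝓝 0) :=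
    fun K hK hK0 => ⟨tendsto_iSup_normG₁ hκ hK.bddAbove hK0 tendsto_abs_atTop_atTop,
      tendsto_iSup_normG₁ hκ hK.bddAbove hK0 tendsto_abs_atBot_atTop⟩
  refine ⟨fun l₀ hl₀ => ?_, hunif⟩
  simpa using hunif {l₀} isCompact_singleton (by simpa using hl₀)
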